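/- For a finite connected graph $G$ with at least two vertices, let $d_{xy}$ denote the graph distance, let $W_G=\frac12\sum_{x,y\in V(G)}d_{xy}$ be the Wiener index, and let $|G|$ be the number of vertices. For the unbiased discrete-time random walk on $G$ (from a vertex the walker moves to a uniformly chosen neighbour), let $H_{x\to y}$ be the expected first time at which the walk started at $x$ is at $y$ (so $H_{x\to x}=0$), and let $$\langle\mathcal H_G\rangle=\frac{1}{|G|(|G|-1)}\sum_{x,y\in V(G)}H_{x\to y}$$ be the mean hitting time. Let $m\ge 0$ be an integer. The $m$-order T-fractal operation replaces every edge $xy$ of a graph by a path $x\,w\,y$ through a new vertex $w$ and attaches $m$ new leaves to $w$. Let $\mathcal T$ be a finite tree with $n\ge 1$ vertices and, for $t\ge 0$, let $\mathcal T^{\mathrm T}_m(t)$ be the graph obtained from $\mathcal T=\mathcal T^{\mathrm T}_m(0)$ by applying the $m$-order T-fractal operation $t$ times (the generalized T-fractal). Then for all $t\ge 0$ $$|\mathcal T^{\mathrm T}_m(t)|=(n-1)(m+2)^t+1,$$ and, if $n\ge 2$, the mean hitting time of $\mathcal T^{\mathrm T}_m(t)$ is finite and equals $$\langle\mathcal H_{\mathcal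 T^{\mathrm T}_m(t)}\rangle=\frac{2}{|\mathcal T^{\mathrm T}_m(t)|}\Big\{f_4^{\,t}\,W_{\mathcal T}-g_4\sum_{i=0}^{t-1}f_4^{\,i}\,|\mathcal T^{\mathrm T}_m(t-1-i)|^2-h_4\sum_{i=0}^{t-1}f_4^{\,i}\,|\mathcal T^{\mathrm T}_m(t-1-i)|+l_4\sum_{i=0}^{t-1}f_4^{\,i}\Big\},$$ where $f_4=2(m+2)^2$, $g_4=m+2$, $h_4=(m-1)(m+2)$ and $l_4=m^2+2m$. -/

import Mathlib

open MeasureTheory ProbabilityTheory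
open scoped ENNReal

universe u

noncomputable section

/-! ### Wiener index -/

/-- The Wiener index `W_G = (1/2) ∑_{u,v} d(u,v)` of a finite graph. -/
def wienerIndex {V : Type u} [Fintype V] (G : SimpleGraph V) : ℝ :=
  (1 / 2) * ∑ x : V, ∑ y : V, (G.dist x y : ℝ)

/-! ### Simple random walk and hitting times -/

open Classical in
/-- The law of one step of the unbiased random walk from `x`: uniform over the neighbours of `x`.
A walker at an isolated vertex stays there. -/
def walkStep {V : Type u} [Fintype V] (G : SimpleGraph V) (x : V) : PMF V :=
  if h : (G.neighborFinset x).Nonempty then PMF.uniformOfFinset (G.neighborFinset x) h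
  else PMF.pure x

/-- The one-step transition kernel of the random walk. -/
def walkKernel {V : Type u} [Fintype V] [MeasurableSpace V] [DiscreteMeasurableSpace V]
    (G : SimpleGraph V) : Kernel V V where
  toFun x := (walkStep G x).toMeasure
  measurable' := measurable_of_countable _

instance walkKernel_isMarkovKernel {V : Type u} [Fintype V] [MeasurableSpace V]
    [DiscreteMeasurableSpace V] (G : SimpleGraph V) : IsMarkovKernel (walkKernel G) :=
  ⟨fun x => PMF.toMeasure.isProbabilityMeasure (walkStep G x)⟩

/-- The transition from the trajectory up to time `k` to the position at time `k + 1`: it depends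
on the current position only. -/
def walkHistoryKernel {V : Type u} [Fintype V] [MeasurableSpace V] [DiscreteMeasurableSpace V]
    (G : SimpleGraph V) (k : ℕ) : Kernel (Finset.Iic k → V) V :=
  (walkKernel G).comap (fun h => h ⟨k, Finset.mem_Iic.2 le_rfl⟩) (measurable_pi_apply _)

instance walkHistoryKernel_isMarkovKernel {V : Type u} [Fintype V] [MeasurableSpace V]
    [DiscreteMeasurableSpace V] (G : SimpleGraph V) (k : ℕ) :
    IsMarkovKernel (walkHistoryKernel G k) := by
  unfold walkHistoryKernel; infer_instance

/-- The law, on the space of trajectories `ℕ → V`, of the random walk started at `x`. -/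
def walkLaw {V : Type u} [Fintype V] [MeasurableSpace V] [DiscreteMeasurableSpace V]
    (G : SimpleGraph V) (x : V) : Measure (ℕ → V) :=
  Kernel.trajMeasure (X := fun _ => V) (Measure.dirac x) (walkHistoryKernel G)

/-- The first time at which a trajectory is at `y` (infinite if it never is). -/
def firstVisit {V : Type u} (y : V) (ω : ℕ → V) : ℝ≥0∞ :=
  ⨅ (k : ℕ) (_ : ω k = y), (k : ℝ≥0∞)

/-- The hitting time `H_{x → y}`: the expected first time at which the random walk started at `x`
is at `y`. -/
def hittingTime {V : Type u} [Fintype V] [MeasurableSpace V] [DiscreteMeasurableSpace V]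
    (G : SimpleGraph V) (x y : V) : ℝ≥0∞ :=
  ∫⁻ ω, firstVisit y ω ∂(walkLaw G x)

/-- The mean hitting time `(1 / (|V| (|V| - 1))) ∑_{x,y} H_{x → y}`. -/
def meanHittingTime {V : Type u} [Fintype V] [MeasurableSpace V] [DiscreteMeasurableSpace V]
    (G : SimpleGraph V) : ℝ≥0∞ :=
  (∑ x : V, ∑ y : V, hittingTime G x y) /
    ((Fintype.card V : ℝ≥0∞) * ((Fintype.card V : ℝ≥0∞) - 1))

/-! ### The T-fractal operation -/

/-- Vertices after the `m`-order T-fractal operation: the old vertices, a new vertex `w` for each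
edge, and `m` further new vertices `w_1, …, w_m` for each edge. -/
abbrev TFractalVertex {V : Type u} (G : SimpleGraph V) (m : ℕ) : Type u :=
  V ⊕ (G.edgeSet ⊕ (G.edgeSet × Fin m))

/-- One orientation of the edges after the operation. -/
def tFractalRel {V : Type u} (G : SimpleGraph V) (m : ℕ) :
    TFractalVertex G m → TFractalVertex G m → Prop
  | .inl x, .inr (.inl e) => x ∈ (e : Sym2 V)
  | .inr (.inl e), .inr (.inr (e', _)) => e = e'
  | _, _ => False

/-- The `m`-order T-fractal operation applied to every edge of `G`: each edge `xy` is replaced by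
the edges `xw`, `wy` through a new vertex `w`, to which `m` new leaves are attached. -/
def tFractalGraph {V : Type u} (G : SimpleGraph V) (m : ℕ) : SimpleGraph (TFractalVertex G m) :=
  SimpleGraph.fromRel (tFractalRel G m)

/-- A finite simple graph bundled with its vertex type. -/
structure FiniteGraph : Type (u + 1) where
  Vertex : Type u
  [fintypeVertex : Fintype Vertex]
  graph : SimpleGraph Vertex

instance FiniteGraph.instFintypeVertex (G : FiniteGraph.{u}) : Fintype G.Vertex :=
  G.fintypeVertex

/-- Vertex sets carry the discrete σ-algebra. -/
instance FiniteGraph.instMeasurableSpaceVertex (G : FiniteGraph.{u}) : MeasurableSpace G.Vertex :=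
  ⊤

instance FiniteGraph.instDiscreteMeasurableSpaceVertex (G : FiniteGraph.{u}) :
    DiscreteMeasurableSpace G.Vertex :=
  ⟨fun _ => trivial⟩

/-- The number `|G|` of vertices. -/
def FiniteGraph.order (G : FiniteGraph.{u}) : ℕ := Fintype.card G.Vertex

open Classical in
/-- The `m`-order T-fractal operation on bundled finite graphs. -/
def FiniteGraph.tFractalStep (m : ℕ) (G : FiniteGraph.{u}) : FiniteGraph.{u} where
  Vertex := TFractalVertex G.graph m
  fintypeVertex := inferInstance
  graph := tFractalGraph G.graph m

/-- The generalized T-fractal: the seed at `t = 0`, followed by `t` iterations of the `m`-order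
T-fractal operation. -/
def generalizedTFractal (m : ℕ) (T : FiniteGraph.{u}) : ℕ → FiniteGraph.{u}
  | 0 => T
  | t + 1 => (generalizedTFractal m T t).tFractalStep m

end

/-!
A finite solution `g` of the first-step equations `g y = 0`, `g z = 1 + ∑ v, P(z, v) g v` is the
hitting time of `y`: after `k` steps the equations unroll to the expected time spent before `y` is
reached, truncated at `k`, plus a remainder at most `∑ z, g z` times the probability that `y` has
not been reached by time `k`; these probabilities are summable, so the remainder vanishes.

On a tree every neighbour of `x ≠ z` but one is farther from `z` than `x`, by exactly one. Hence
`(n - 1) d(x, y) + σ(y) - σ(x)`, where `σ(v) = ∑ u, d(v, u)`, solves the first-step equations, and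
summing over `x` and `y` makes the mean hitting time `2 W / n`.

The T-fractal operation doubles the distances between old vertices. The transmission of each vertex
of the new tree is, up to a constant depending on the kind of vertex, `m + 2` times the sum of its
distances to the old vertices. Summing over all vertices, and exchanging the order of summation,
leaves only the distances from the old vertices, so the new Wiener index is `2 (m + 2) ^ 2` times
the old one plus a quadratic polynomial in the order; solving this recurrence gives the formula.
-/

section Tree

variable {V : Type*} {G : SimpleGraph V}

theorem dist_eq_dist_add_one_of_adj_of_isTree (hG : G.IsTree) {u v : V} (huv : G.Adj u v) (z : V) :
    G.dist u z = G.dist v z + 1 ∨ G.dist v z = G.dist u z + 1 := by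
  rw [G.dist_comm (u := u), G.dist_comm (u := v)]
  exact hG.dist_eq_dist_add_one_of_adj z huv

theorem exists_adj_dist_add_one_eq_of_isTree (hG : G.IsTree) {x z : V} (hxz : x ≠ z) :
    ∃ p, G.Adj x p ∧ G.dist p z + 1 = G.dist x z ∧
      ∀ u, G.Adj x u → u ≠ p → G.dist u z = G.dist x z + 1 := by
  obtain ⟨w, hw, hlen⟩ := hG.connected.exists_path_of_dist x z
  have hnil : ¬ w.Nil := SimpleGraph.Walk.not_nil_of_ne hxz
  have hcloser (u : V) (hu : G.Adj x u) (hd : G.dist x z = G.dist u z + 1) : u = w.snd := by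
    obtain ⟨q, hq⟩ := hG.connected.exists_walk_length_eq_dist u z
    have hcons : (q.cons hu).IsPath :=
      SimpleGraph.Walk.isPath_of_length_eq_dist _ (by simp [hq, hd])
    have heq : q.cons hu = w :=
      congrArg Subtype.val ((hG.isAcyclic.subsingleton_path x z).elim ⟨_, hcons⟩ ⟨w, hw⟩)
    rw [← heq, SimpleGraph.Walk.snd_cons]
  refine ⟨w.snd, w.adj_snd hnil, ?_, fun u hu hne ↦
    (dist_eq_dist_add_one_of_adj_of_isTree hG hu z).resolve_left fun hd ↦ hne (hcloser u hu hd)⟩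
  have hle : G.dist w.snd z ≤ w.tail.length := G.dist_le w.tail
  have htail := w.length_tail_add_one hnil
  have := dist_eq_dist_add_one_of_adj_of_isTree hG (w.adj_snd hnil) z
  omega

variable [Fintype V]

theorem card_edgeSet_add_one_of_isTree [Fintype G.edgeSet] (hG : G.IsTree) :
    Fintype.card G.edgeSet + 1 = Fintype.card V := by
  rw [← SimpleGraph.edgeFinset_card, hG.card_edgeFinset]

/-- The transmission `σ(v) = ∑ u, d(v, u)` of a vertex: twice the Wiener index is its sum over all
vertices. -/
noncomputable def transmission (G : SimpleGraph V) (v : V) : ℝ :=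
  ∑ u, (G.dist v u : ℝ)

theorem sum_transmission (G : SimpleGraph V) : ∑ v, transmission G v = 2 * wienerIndex G := by
  simp only [transmission, wienerIndex]
  ring

variable [DecidableRel G.Adj]

theorem sum_degree_of_isTree (hG : G.IsTree) :
    ∑ x, (G.degree x : ℝ) = 2 * ((Fintype.card V : ℝ) - 1) := by
  rw [← Nat.cast_sum, G.sum_degrees_eq_twice_card_edges, ← hG.card_edgeFinset]
  push_cast
  ring

theorem sum_neighborFinset_dist_of_isTree [DecidableEq V] (hG : G.IsTree) (x z : V) :
    ∑ u ∈ G.neighborFinset x, (G.dist u z : ℝ) =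
      G.degree x * (G.dist x z + 1) - 2 + if x = z then 2 else 0 := by
  split_ifs with hxz
  · subst hxz
    have hone : ∀ u ∈ G.neighborFinset x, (G.dist u x : ℝ) = 1 := fun u hu ↦ by
      exact_mod_cast SimpleGraph.dist_eq_one_iff_adj.2 ((G.mem_neighborFinset x u).1 hu).symm
    simp [Finset.sum_congr rfl hone]
  · obtain ⟨p, hp, hpd, hu⟩ := exists_adj_dist_add_one_eq_of_isTree hG hxz
    have hp' : p ∈ G.neighborFinset x := (G.mem_neighborFinset x p).2 hp
    have hterm : ∀ u ∈ G.neighborFinset x,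
        (G.dist u z : ℝ) = G.dist x z + 1 - if u = p then 2 else 0 := fun u hxu ↦ by
      split_ifs with hup
      · rw [hup, ← hpd]; push_cast; ring
      · rw [hu u ((G.mem_neighborFinset x u).1 hxu) hup]; simp
    rw [Finset.sum_congr rfl hterm, Finset.sum_sub_distrib, Finset.sum_ite_eq', if_pos hp']
    simp [mul_add]

theorem sum_neighborFinset_transmission_of_isTree (hG : G.IsTree) (x : V) :
    ∑ u ∈ G.neighborFinset x, transmission G u =
      G.degree x * (transmission G x + Fintype.card V) - 2 * (Fintype.card V - 1) := by
  classical
  simp only [transmission]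
  rw [Finset.sum_comm]
  simp only [sum_neighborFinset_dist_of_isTree hG x, Finset.sum_add_distrib,
    Finset.sum_sub_distrib, ← Finset.mul_sum, Finset.sum_ite_eq, Finset.mem_univ, if_true,
    Finset.sum_const, Finset.card_univ, nsmul_eq_mul]
  ring

-- Pair the function `d = dist · z` with its Laplacian: `⟨d, L d⟩` is the number `n - 1` of edges,
-- because `d` changes by exactly one along each edge, while `L d = 2 - degree` away from `z`.
theorem sum_degree_mul_dist_of_isTree (hG : G.IsTree) (z : V) :
    ∑ x, (G.degree x : ℝ) * G.dist x z =
      2 * transmission G z - ((Fintype.card V : ℝ) - 1) := by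
  classical
  let d : V → ℝ := fun x ↦ G.dist x z
  have henergy : ∑ x, d x * (G.lapMatrix ℝ).mulVec d x = (Fintype.card V : ℝ) - 1 := by
    have hsq (x u : V) :
        (if G.Adj x u then (d x - d u) ^ 2 else 0) = if G.Adj x u then 1 else 0 := by
      split_ifs with hxu
      · rcases dist_eq_dist_add_one_of_adj_of_isTree hG hxu z with h | h <;> simp [d, h]
      · rfl
    have hgreen := SimpleGraph.lapMatrix_toLinearMap₂' ℝ G d
    simp only [Matrix.toLinearMap₂'_apply', dotProduct, hsq, ← G.degree_eq_sum_if_adj,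
      sum_degree_of_isTree hG] at hgreen
    linarith
  have hlap (x : V) : d x * (G.lapMatrix ℝ).mulVec d x = 2 * d x - G.degree x * d x := by
    rw [G.lapMatrix_mulVec_apply, sum_neighborFinset_dist_of_isTree hG x z]
    split_ifs with hxz
    · simp [d, hxz]
    · ring
  simp only [hlap, Finset.sum_sub_distrib, ← Finset.mul_sum] at henergy
  have htrans : transmission G z = ∑ x, d x := by simp only [transmission, d, G.dist_comm]
  linarith

end Tree

/-- The event that a trajectory has not been at `y` up to and including time `k`. -/
def avoidsUpTo {V : Type*} (y : V) (k : ℕ) : Set (ℕ → V) :=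
  {ω | ∀ i ≤ k, ω i ≠ y}

section Avoidance

variable {V : Type*} (y : V) (k : ℕ)

theorem avoidsUpTo_eq_preimage_frestrictLe :
    avoidsUpTo y k = Preorder.frestrictLe (π := fun _ ↦ V) k ⁻¹' {h | ∀ i, h i ≠ y} := by
  ext ω
  simp [avoidsUpTo, Preorder.frestrictLe]

theorem avoidsUpTo_zero : avoidsUpTo y 0 = {ω | ω 0 ≠ y} := by
  simp [avoidsUpTo]

theorem avoidsUpTo_succ : avoidsUpTo y (k + 1) = {ω | ω (k + 1) ≠ y} ∩ avoidsUpTo y k := by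
  ext ω
  simp [avoidsUpTo, Nat.le_succ_iff, or_imp, forall_and, and_comm]

theorem firstVisit_eq_tsum_indicator_avoidsUpTo (ω : ℕ → V) :
    firstVisit y ω = ∑' k, (avoidsUpTo y k).indicator 1 ω := by
  classical
  by_cases h : ∃ k, ω k = y
  · have hfirst : firstVisit y ω = Nat.find h :=
      le_antisymm (iInf₂_le (Nat.find h) (Nat.find_spec h))
        (le_iInf₂ fun k hk ↦ by exact_mod_cast Nat.find_min' h hk)
    have hmem (k : ℕ) : ω ∈ avoidsUpTo y k ↔ k ∈ Finset.range (Nat.find h) := by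
      simp [avoidsUpTo, Nat.lt_find_iff]
    simp only [Set.indicator_apply, hmem, Pi.one_apply]
    rw [hfirst, tsum_eq_sum (s := Finset.range (Nat.find h)) (fun k hk ↦ if_neg hk),
      Finset.sum_congr rfl fun k hk ↦ if_pos hk]
    simp
  · push Not at h
    simp [firstVisit, avoidsUpTo, h]

variable [MeasurableSpace V] [MeasurableSingletonClass V]

theorem measurableSet_setOf_apply_ne : MeasurableSet {ω : ℕ → V | ω k ≠ y} :=
  (measurableSet_singleton y).compl.preimage (measurable_pi_apply k)

theorem measurableSet_avoidsUpTo : MeasurableSet (avoidsUpTo y k) := by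
  simp only [avoidsUpTo, Set.ofPred_forall]
  exact .biInter (Set.to_countable _) fun i _ ↦ measurableSet_setOf_apply_ne y i

end Avoidance

section FirstStepAnalysis

variable {V : Type*} [Fintype V] [MeasurableSpace V] [DiscreteMeasurableSpace V]
  (G : SimpleGraph V)

theorem map_frestrictLe_zero_walkLaw (x : V) :
    (walkLaw G x).map (Preorder.frestrictLe (π := fun _ ↦ V) 0) = Measure.dirac (fun _ ↦ x) := by
  have hdirac : (Measure.dirac x).map (MeasurableEquiv.piUnique fun _ : Finset.Iic 0 ↦ V).symm =
      Measure.dirac fun _ ↦ x := by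
    rw [Measure.map_dirac' (MeasurableEquiv.measurable _)]
    rfl
  have hbind := congrArg
    (fun μ ↦ (μ.bind (Kernel.traj (X := fun _ ↦ V) (walkHistoryKernel G) 0)).map
      (Preorder.frestrictLe (π := fun _ ↦ V) 0)) hdirac
  refine hbind.trans ?_
  rw [Measure.dirac_bind (Kernel.measurable _), Kernel.traj_map_frestrictLe_apply,
    Kernel.partialTraj_self, Kernel.id_apply]

theorem lintegral_walkLaw_zero (x : V) (f : V → ℝ≥0∞) : ∫⁻ ω, f (ω 0) ∂walkLaw G x = f x := by
  have hf : Measurable f := .of_discrete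
  calc ∫⁻ ω, f (ω 0) ∂walkLaw G x
      = ∫⁻ h, f (h ⟨0, by simp⟩)
          ∂(walkLaw G x).map (Preorder.frestrictLe (π := fun _ ↦ V) 0) := by
        rw [lintegral_map (by fun_prop) (by fun_prop)]
        rfl
    _ = f x := by rw [map_frestrictLe_zero_walkLaw, lintegral_dirac' _ (by fun_prop)]

theorem setLIntegral_walkLaw_succ (x : V) (k : ℕ) (B : Set (Finset.Iic k → V)) (f : V → ℝ≥0∞) :
    ∫⁻ ω in Preorder.frestrictLe (π := fun _ ↦ V) k ⁻¹' B, f (ω (k + 1)) ∂walkLaw G x =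
      ∫⁻ ω in Preorder.frestrictLe (π := fun _ ↦ V) k ⁻¹' B,
        ∫⁻ v, f v ∂walkKernel G (ω k) ∂walkLaw G x := by
  have hf : Measurable fun p : (Finset.Iic k → V) × V ↦ f p.2 := by
    have : Measurable f := .of_discrete
    fun_prop
  have hB : MeasurableSet B := .of_discrete
  have hmarkov := congrArg (fun μ ↦ ∫⁻ p in B ×ˢ Set.univ, f p.2 ∂μ)
    (Kernel.map_frestrictLe_trajMeasure_compProd_eq_map_trajMeasure
      (X := fun _ ↦ V) (μ₀ := Measure.dirac x) (κ := walkHistoryKernel G) (a := k))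
  rw [Measure.setLIntegral_compProd hf hB .univ, setLIntegral_map hB .of_discrete (by fun_prop),
    setLIntegral_map (hB.prod .univ) hf (by fun_prop)] at hmarkov
  simp only [Measure.restrict_univ] at hmarkov
  rw [Set.mk_preimage_prod, Set.preimage_univ, Set.inter_univ] at hmarkov
  exact hmarkov.symm

theorem hittingTime_eq_tsum_walkLaw_avoidsUpTo (x y : V) :
    hittingTime G x y = ∑' k, walkLaw G x (avoidsUpTo y k) := by
  simp only [hittingTime, firstVisit_eq_tsum_indicator_avoidsUpTo]
  rw [lintegral_tsum fun k ↦ (measurable_one.indicator (measurableSet_avoidsUpTo y k)).aemeasurable]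
  simp only [lintegral_indicator_one (measurableSet_avoidsUpTo y _)]

variable {G} {y : V} {g : V → ℝ≥0∞}

theorem setLIntegral_avoidsUpTo (hy : g y = 0)
    (hg : ∀ z, z ≠ y → g z = 1 + ∫⁻ v, g v ∂walkKernel G z) (x : V) (k : ℕ) :
    ∫⁻ ω in avoidsUpTo y k, g (ω k) ∂walkLaw G x =
      walkLaw G x (avoidsUpTo y k) + ∫⁻ ω in avoidsUpTo y (k + 1), g (ω (k + 1)) ∂walkLaw G x := by
  have hnext : ∫⁻ ω in avoidsUpTo y (k + 1), g (ω (k + 1)) ∂walkLaw G x =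
      ∫⁻ ω in avoidsUpTo y k, g (ω (k + 1)) ∂walkLaw G x := by
    have hsupp : (fun ω : ℕ → V ↦ g (ω (k + 1))).support ⊆ {ω | ω (k + 1) ≠ y} :=
      fun ω hω h ↦ hω (by simp only [h, hy])
    rw [avoidsUpTo_succ, ← setLIntegral_indicator (measurableSet_setOf_apply_ne y (k + 1)),
      Set.indicator_eq_self.2 hsupp]
  rw [hnext, avoidsUpTo_eq_preimage_frestrictLe, setLIntegral_walkLaw_succ,
    ← avoidsUpTo_eq_preimage_frestrictLe, ← setLIntegral_one, ← lintegral_add_left measurable_const]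
  exact setLIntegral_congr_fun (measurableSet_avoidsUpTo y k) fun ω hω ↦ hg _ (hω k le_rfl)

theorem eq_sum_walkLaw_avoidsUpTo_add (hy : g y = 0)
    (hg : ∀ z, z ≠ y → g z = 1 + ∫⁻ v, g v ∂walkKernel G z) (x : V) (k : ℕ) :
    g x = ∑ j ∈ Finset.range k, walkLaw G x (avoidsUpTo y j) +
      ∫⁻ ω in avoidsUpTo y k, g (ω k) ∂walkLaw G x := by
  induction k with
  | zero =>
    have hsupp : (fun ω : ℕ → V ↦ g (ω 0)).support ⊆ avoidsUpTo y 0 := fun ω hω ↦ by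
      rw [avoidsUpTo_zero]
      exact fun h ↦ hω (by simp only [h, hy])
    rw [Finset.sum_range_zero, zero_add, setLIntegral_eq_of_support_subset hsupp,
      lintegral_walkLaw_zero]
  | succ k ih => rw [Finset.sum_range_succ, add_assoc, ← setLIntegral_avoidsUpTo hy hg, ← ih]

theorem hittingTime_eq_of_first_step (hy : g y = 0) (hfin : ∀ z, g z ≠ ⊤)
    (hg : ∀ z, z ≠ y → g z = 1 + ∫⁻ v, g v ∂walkKernel G z) (x : V) :
    hittingTime G x y = g x := by
  have htele := eq_sum_walkLaw_avoidsUpTo_add hy hg x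
  have hsummable : ∑' k, walkLaw G x (avoidsUpTo y k) ≠ ⊤ :=
    ne_top_of_le_ne_top (hfin x) <| ENNReal.tsum_le_of_sum_range_le fun k ↦
      le_self_add.trans (htele k).ge
  have hbound (k : ℕ) : ∫⁻ ω in avoidsUpTo y k, g (ω k) ∂walkLaw G x ≤
      (∑ z, g z) * walkLaw G x (avoidsUpTo y k) := by
    rw [← setLIntegral_const]
    exact lintegral_mono fun ω ↦
      Finset.single_le_sum (f := g) (fun _ _ ↦ zero_le) (Finset.mem_univ (ω k))
  have hremainder : Filter.Tendsto (fun k ↦ ∫⁻ ω in avoidsUpTo y k, g (ω k) ∂walkLaw G x)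
      Filter.atTop (nhds 0) := by
    refine tendsto_of_tendsto_of_tendsto_of_le_of_le tendsto_const_nhds ?_ (fun _ ↦ zero_le) hbound
    simpa using ENNReal.Tendsto.const_mul (ENNReal.tendsto_atTop_zero_of_tsum_ne_top hsummable)
      (Or.inr (ENNReal.sum_ne_top.2 fun z _ ↦ hfin z))
  have hlim := (ENNReal.summable.hasSum.tendsto_sum_nat
    (f := fun k ↦ walkLaw G x (avoidsUpTo y k))).add hremainder
  simp only [← htele, add_zero] at hlim
  rw [hittingTime_eq_tsum_walkLaw_avoidsUpTo]
  exact tendsto_nhds_unique hlim tendsto_const_nhds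

end FirstStepAnalysis

section TreeHittingTime

variable {V : Type*} [Fintype V] {G : SimpleGraph V}

theorem lintegral_walkKernel [MeasurableSpace V] [DiscreteMeasurableSpace V] [DecidableRel G.Adj]
    {x : V} (hx : (G.neighborFinset x).Nonempty) (f : V → ℝ≥0∞) :
    ∫⁻ v, f v ∂walkKernel G x = (∑ v ∈ G.neighborFinset x, f v) / G.degree x := by
  classical
  have hkernel : walkKernel G x = (PMF.uniformOfFinset (G.neighborFinset x) hx).toMeasure := by
    change (walkStep G x).toMeasure = _
    rw [walkStep, dif_pos (by convert hx)]
    congr!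
  rw [hkernel, lintegral_fintype, ENNReal.div_eq_inv_mul, Finset.mul_sum]
  simp only [PMF.toMeasure_apply_singleton _ _ (measurableSet_singleton _),
    PMF.uniformOfFinset_apply, mul_comm (f _), ite_mul, zero_mul, Finset.sum_ite_mem,
    Finset.univ_inter, SimpleGraph.card_neighborFinset_eq_degree]

/-- The closed form `(n - 1) d(x, y) + σ(y) - σ(x)` of the hitting time `H_{x → y}` of a tree on `n`
vertices, where `σ` is the transmission. -/
noncomputable def treeHittingTime (G : SimpleGraph V) (x y : V) : ℝ :=
  ((Fintype.card V : ℝ) - 1) * G.dist x y + transmission G y - transmission G x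

theorem treeHittingTime_self (x : V) : treeHittingTime G x x = 0 := by
  simp [treeHittingTime]

theorem treeHittingTime_nonneg (hG : G.Connected) (x y : V) : 0 ≤ treeHittingTime G x y := by
  classical
  have hterm (z : V) : (G.dist x z : ℝ) - G.dist y z ≤ G.dist x y := by
    rw [sub_le_iff_le_add]
    exact_mod_cast hG.dist_triangle
  have hsum : ∑ z ∈ Finset.univ.erase x, ((G.dist x z : ℝ) - G.dist y z) ≤
      ((Fintype.card V : ℝ) - 1) * G.dist x y := by
    refine (Finset.sum_le_card_nsmul _ _ _ fun z _ ↦ hterm z).trans_eq ?_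
    rw [Finset.card_erase_of_mem (Finset.mem_univ x), Finset.card_univ, nsmul_eq_mul,
      Nat.cast_pred (Fintype.card_pos_iff.2 ⟨x⟩)]
  have hsplit := Finset.sum_erase_add Finset.univ
    (fun z ↦ (G.dist x z : ℝ) - G.dist y z) (Finset.mem_univ x)
  simp only [Finset.sum_sub_distrib, SimpleGraph.dist_self, Nat.cast_zero] at hsplit hsum
  have : (0 : ℝ) ≤ G.dist y x := Nat.cast_nonneg _
  simp only [treeHittingTime, transmission]
  linarith

theorem sum_neighborFinset_treeHittingTime [DecidableRel G.Adj] (hG : G.IsTree) {x y : V}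
    (hxy : x ≠ y) :
    ∑ v ∈ G.neighborFinset x, treeHittingTime G v y =
      G.degree x * (treeHittingTime G x y - 1) := by
  classical
  simp only [treeHittingTime, Finset.sum_sub_distrib, Finset.sum_add_distrib, ← Finset.mul_sum,
    sum_neighborFinset_dist_of_isTree hG, sum_neighborFinset_transmission_of_isTree hG, if_neg hxy,
    Finset.sum_const, SimpleGraph.card_neighborFinset_eq_degree, nsmul_eq_mul]
  ring

theorem sum_sum_treeHittingTime (G : SimpleGraph V) :
    ∑ x, ∑ y, treeHittingTime G x y = ((Fintype.card V : ℝ) - 1) * (2 * wienerIndex G) := by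
  have hdist : ∑ x, ∑ y, (G.dist x y : ℝ) = 2 * wienerIndex G := sum_transmission G
  simp only [treeHittingTime, Finset.sum_sub_distrib, Finset.sum_add_distrib, ← Finset.mul_sum,
    hdist, Finset.sum_const, Finset.card_univ, nsmul_eq_mul]
  ring

theorem wienerIndex_nonneg (G : SimpleGraph V) : 0 ≤ wienerIndex G := by
  unfold wienerIndex
  positivity

variable [MeasurableSpace V] [DiscreteMeasurableSpace V]

theorem hittingTime_of_isTree (hG : G.IsTree) (x y : V) :
    hittingTime G x y = ENNReal.ofReal (treeHittingTime G x y) := by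
  classical
  refine hittingTime_eq_of_first_step (g := fun z ↦ ENNReal.ofReal (treeHittingTime G z y))
    (by simp [treeHittingTime_self]) (fun _ ↦ ENNReal.ofReal_ne_top) (fun z hzy ↦ ?_) x
  obtain ⟨p, hp, -⟩ := exists_adj_dist_add_one_eq_of_isTree hG hzy
  have hne : (G.neighborFinset z).Nonempty := ⟨p, (G.mem_neighborFinset z p).2 hp⟩
  have hdeg : (0 : ℝ) < G.degree z := by exact_mod_cast hne.card_pos
  have hsum := sum_neighborFinset_treeHittingTime hG hzy
  have hmean : treeHittingTime G z y =
      1 + (∑ v ∈ G.neighborFinset z, treeHittingTime G v y) / G.degree z := by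
    rw [hsum]
    field_simp
    ring
  have hnonneg : 0 ≤ ∑ v ∈ G.neighborFinset z, treeHittingTime G v y :=
    Finset.sum_nonneg fun v _ ↦ treeHittingTime_nonneg hG.connected v y
  rw [hmean, ENNReal.ofReal_add zero_le_one (div_nonneg hnonneg hdeg.le), ENNReal.ofReal_one,
    ENNReal.ofReal_div_of_pos hdeg, ENNReal.ofReal_natCast,
    ENNReal.ofReal_sum_of_nonneg fun v _ ↦ treeHittingTime_nonneg hG.connected v y,
    lintegral_walkKernel hne]

theorem meanHittingTime_of_isTree (hG : G.IsTree) (hV : 2 ≤ Fintype.card V) :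
    meanHittingTime G = ENNReal.ofReal (2 / Fintype.card V * wienerIndex G) := by
  have hn : (2 : ℝ) ≤ Fintype.card V := by exact_mod_cast hV
  have hnonneg := treeHittingTime_nonneg hG.connected
  have hsum : ∑ x, ∑ y, hittingTime G x y =
      ENNReal.ofReal (((Fintype.card V : ℝ) - 1) * (2 * wienerIndex G)) := by
    simp only [hittingTime_of_isTree hG, ← sum_sum_treeHittingTime]
    rw [ENNReal.ofReal_sum_of_nonneg fun x _ ↦ Finset.sum_nonneg fun y _ ↦ hnonneg x y]
    simp only [ENNReal.ofReal_sum_of_nonneg fun y _ ↦ hnonneg _ y]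
  have hpairs : (Fintype.card V : ℝ≥0∞) * ((Fintype.card V : ℝ≥0∞) - 1) =
      ENNReal.ofReal (Fintype.card V * (Fintype.card V - 1)) := by
    rw [ENNReal.ofReal_mul (by positivity), ENNReal.ofReal_sub _ zero_le_one,
      ENNReal.ofReal_natCast, ENNReal.ofReal_one]
  have hcancel : (Fintype.card V : ℝ) - 1 ≠ 0 := by linarith
  rw [meanHittingTime, hsum, hpairs, ← ENNReal.ofReal_div_of_pos (by nlinarith)]
  congr 1
  field_simp

end TreeHittingTime

namespace tFractalGraph

section Adjacency

variable {V : Type*} {G : SimpleGraph V} {m : ℕ}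

@[simp]
theorem not_adj_old_old (x y : V) : ¬ (tFractalGraph G m).Adj (.inl x) (.inl y) := by
  simp [tFractalGraph, tFractalRel]

@[simp]
theorem adj_old_mid (x : V) (e : G.edgeSet) :
    (tFractalGraph G m).Adj (.inl x) (.inr (.inl e)) ↔ x ∈ (e : Sym2 V) := by
  simp [tFractalGraph, tFractalRel]

@[simp]
theorem adj_mid_old (e : G.edgeSet) (x : V) :
    (tFractalGraph G m).Adj (.inr (.inl e)) (.inl x) ↔ x ∈ (e : Sym2 V) := by
  simp [tFractalGraph, tFractalRel]

@[simp]
theorem not_adj_old_leaf (x : V) (p : G.edgeSet × Fin m) :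
    ¬ (tFractalGraph G m).Adj (.inl x) (.inr (.inr p)) := by
  simp [tFractalGraph, tFractalRel]

@[simp]
theorem not_adj_leaf_old (p : G.edgeSet × Fin m) (x : V) :
    ¬ (tFractalGraph G m).Adj (.inr (.inr p)) (.inl x) := by
  simp [tFractalGraph, tFractalRel]

@[simp]
theorem not_adj_mid_mid (e f : G.edgeSet) :
    ¬ (tFractalGraph G m).Adj (.inr (.inl e)) (.inr (.inl f)) := by
  simp [tFractalGraph, tFractalRel]

@[simp]
theorem adj_mid_leaf (e : G.edgeSet) (p : G.edgeSet × Fin m) :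
    (tFractalGraph G m).Adj (.inr (.inl e)) (.inr (.inr p)) ↔ e = p.1 := by
  simp [tFractalGraph, tFractalRel]

@[simp]
theorem adj_leaf_mid (p : G.edgeSet × Fin m) (e : G.edgeSet) :
    (tFractalGraph G m).Adj (.inr (.inr p)) (.inr (.inl e)) ↔ p.1 = e := by
  simp [tFractalGraph, tFractalRel, eq_comm]

@[simp]
theorem not_adj_leaf_leaf (p q : G.edgeSet × Fin m) :
    ¬ (tFractalGraph G m).Adj (.inr (.inr p)) (.inr (.inr q)) := by
  simp [tFractalGraph, tFractalRel]

end Adjacency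

section Distance

variable {V : Type*} {G : SimpleGraph V} (m : ℕ)

theorem exists_walk_length_eq_two_mul {x y : V} (w : G.Walk x y) :
    ∃ w' : (tFractalGraph G m).Walk (.inl x) (.inl y), w'.length = 2 * w.length := by
  induction w with
  | nil => exact ⟨.nil, rfl⟩
  | @cons a b c hab w ih =>
    obtain ⟨w', hw'⟩ := ih
    let e : G.edgeSet := ⟨s(a, b), hab⟩
    have hae : (tFractalGraph G m).Adj (.inl a) (.inr (.inl e)) := by simp [e]
    have heb : (tFractalGraph G m).Adj (.inr (.inl e)) (.inl b) := by simp [e]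
    exact ⟨.cons hae (.cons heb w'), by simp only [SimpleGraph.Walk.length_cons, hw']; ring⟩

theorem connected (hG : G.Connected) : (tFractalGraph G m).Connected := by
  obtain ⟨x₀⟩ := hG.nonempty
  have hold (x : V) : (tFractalGraph G m).Reachable (.inl x) (.inl x₀) := by
    obtain ⟨w⟩ := hG x x₀
    exact (exists_walk_length_eq_two_mul m w).nonempty
  have hmid (e : G.edgeSet) : (tFractalGraph G m).Reachable (.inr (.inl e)) (.inl x₀) := by
    have hadj := (adj_mid_old (m := m) e _).2 (Sym2.out_fst_mem (e : Sym2 V))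
    exact hadj.reachable.trans (hold _)
  have hleaf (p : G.edgeSet × Fin m) :
      (tFractalGraph G m).Reachable (.inr (.inr p)) (.inl x₀) :=
    ((adj_leaf_mid p p.1).2 rfl).reachable.trans (hmid p.1)
  rw [SimpleGraph.connected_iff_exists_forall_reachable]
  refine ⟨.inl x₀, ?_⟩
  rintro (x | e | p)
  exacts [(hold x).symm, (hmid e).symm, (hleaf p).symm]

variable {m}

theorem two_mul_dist_le_length_walk (hG : G.Connected) {y : V} {u : TFractalVertex G m}
    (w : (tFractalGraph G m).Walk u (.inl y)) :
    match (generalizing := false) u with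
    | .inl x => 2 * G.dist x y ≤ w.length
    | .inr (.inl e) => ∀ a ∈ (e : Sym2 V), 2 * G.dist a y ≤ w.length + 1
    | .inr (.inr p) => ∀ a ∈ (p.1 : Sym2 V), 2 * G.dist a y ≤ w.length + 2 := by
  have hendpoints (e : G.edgeSet) {a b : V} (ha : a ∈ (e : Sym2 V)) (hb : b ∈ (e : Sym2 V)) :
      G.dist a y ≤ G.dist b y + 1 := by
    rcases eq_or_ne a b with rfl | hab
    · exact Nat.le_succ _
    · have hadj : G.Adj a b := by
        rw [← SimpleGraph.mem_edgeSet, ← (Sym2.mem_and_mem_iff hab).1 ⟨ha, hb⟩]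
        exact e.2
      have := hG.dist_triangle (u := a) (v := b) (w := y)
      rw [SimpleGraph.dist_eq_one_iff_adj.2 hadj] at this
      omega
  generalize hv : (Sum.inl y : TFractalVertex G m) = v at w
  induction w with
  | nil => simp [← hv]
  | @cons u u' v huu' w ih =>
    specialize ih hv
    rw [SimpleGraph.Walk.length_cons]
    rcases u with x | e | p <;> rcases u' with x' | e' | p' <;>
      simp only [not_adj_old_old, adj_old_mid, not_adj_old_leaf, adj_mid_old, not_adj_mid_mid,
        adj_mid_leaf, not_adj_leaf_old, adj_leaf_mid, not_adj_leaf_leaf] at huu' <;>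
      dsimp only at ih ⊢
    · exact ih x huu'
    · intro a ha
      have := hendpoints e ha huu'
      omega
    · subst huu'
      exact ih
    · subst huu'
      intro a ha
      have := ih a ha
      omega

theorem dist_old_old (hG : G.Connected) (x y : V) :
    (tFractalGraph G m).dist (.inl x) (.inl y) = 2 * G.dist x y := by
  apply le_antisymm
  · obtain ⟨w, hw⟩ := hG.exists_walk_length_eq_dist x y
    obtain ⟨w', hw'⟩ := exists_walk_length_eq_two_mul m w
    rw [← hw, ← hw']
    exact SimpleGraph.dist_le w'
  · obtain ⟨w, hw⟩ := (connected m hG).exists_walk_length_eq_dist (.inl x) (.inl y)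
    rw [← hw]
    exact two_mul_dist_le_length_walk hG w

end Distance

section Degree

variable {V : Type*} [Fintype V] {G : SimpleGraph V} [Fintype G.edgeSet] {m : ℕ}

omit [Fintype G.edgeSet] in
theorem card_filter_mem_edge [DecidableEq V] (e : G.edgeSet) :
    (Finset.univ.filter fun x ↦ x ∈ (e : Sym2 V)).card = 2 := by
  have hends : (Finset.univ.filter fun x ↦ x ∈ (e : Sym2 V)) = (e : Sym2 V).toFinset := by
    ext x
    simp
  rw [hends, Sym2.card_toFinset_of_not_isDiag _ (G.not_isDiag_of_mem_edgeSet e.2)]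

theorem sum_sum_edgeSet_mem [DecidableEq V] {M : Type*} [AddCommMonoid M] (f : G.edgeSet → M) :
    ∑ x, ∑ e : G.edgeSet, (if x ∈ (e : Sym2 V) then f e else 0) = 2 • ∑ e, f e := by
  rw [Finset.sum_comm]
  simp only [← Finset.sum_filter, Finset.sum_const, card_filter_mem_edge, Finset.smul_sum]

omit [Fintype V] in
theorem sum_edgeSet_mem_one [DecidableEq V] (x : V) [Fintype (G.neighborSet x)] :
    ∑ e : G.edgeSet, (if x ∈ (e : Sym2 V) then 1 else 0) = G.degree x := by
  rw [← SimpleGraph.card_incidenceFinset_eq_degree, ← Finset.card_filter,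
    ← Finset.card_map (Function.Embedding.subtype (· ∈ G.edgeSet))]
  congr 1
  ext e
  simp [SimpleGraph.incidenceSet, and_comm]

variable [DecidableRel (tFractalGraph G m).Adj] {M : Type*} [AddCommMonoid M]
  (f : TFractalVertex G m → M)

theorem sum_neighborFinset_old [DecidableEq V] (x : V) :
    ∑ u ∈ (tFractalGraph G m).neighborFinset (.inl x), f u =
      ∑ e : G.edgeSet, if x ∈ (e : Sym2 V) then f (.inr (.inl e)) else 0 := by
  simp [SimpleGraph.neighborFinset_eq_filter, Finset.sum_filter, Fintype.sum_sum_type]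

theorem sum_neighborFinset_mid [DecidableEq V] (e : G.edgeSet) :
    ∑ u ∈ (tFractalGraph G m).neighborFinset (.inr (.inl e)), f u =
      ∑ a with a ∈ (e : Sym2 V), f (.inl a) + ∑ i, f (.inr (.inr (e, i))) := by
  simp [SimpleGraph.neighborFinset_eq_filter, Finset.sum_filter, Fintype.sum_sum_type,
    Fintype.sum_prod_type_right]

theorem sum_neighborFinset_leaf (p : G.edgeSet × Fin m) :
    ∑ u ∈ (tFractalGraph G m).neighborFinset (.inr (.inr p)), f u = f (.inr (.inl p.1)) := by
  classical
  simp [SimpleGraph.neighborFinset_eq_filter, Finset.sum_filter, Fintype.sum_sum_type]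

theorem degree_old [DecidableRel G.Adj] (x : V) :
    (tFractalGraph G m).degree (.inl x) = G.degree x := by
  classical
  rw [← SimpleGraph.card_neighborFinset_eq_degree, Finset.card_eq_sum_ones,
    sum_neighborFinset_old, sum_edgeSet_mem_one]

theorem degree_mid (e : G.edgeSet) : (tFractalGraph G m).degree (.inr (.inl e)) = m + 2 := by
  classical
  rw [← SimpleGraph.card_neighborFinset_eq_degree, Finset.card_eq_sum_ones,
    sum_neighborFinset_mid, ← Finset.card_eq_sum_ones, card_filter_mem_edge]
  simp [add_comm]

theorem degree_leaf (p : G.edgeSet × Fin m) :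
    (tFractalGraph G m).degree (.inr (.inr p)) = 1 := by
  rw [← SimpleGraph.card_neighborFinset_eq_degree, Finset.card_eq_sum_ones,
    sum_neighborFinset_leaf]

end Degree

section Order

variable {V : Type*} {G : SimpleGraph V} (m : ℕ)

theorem nat_card_edgeSet [Finite V] :
    Nat.card (tFractalGraph G m).edgeSet = (m + 2) * Nat.card G.edgeSet := by
  classical
  have := Fintype.ofFinite V
  have hG := G.sum_degrees_eq_twice_card_edges
  have hG' := (tFractalGraph G m).sum_degrees_eq_twice_card_edges
  simp only [Fintype.sum_sum_type, degree_old, degree_mid, degree_leaf, hG, Finset.sum_const,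
    Finset.card_univ, Fintype.card_prod, Fintype.card_fin, smul_eq_mul,
    SimpleGraph.edgeFinset_card] at hG'
  rw [Nat.card_eq_fintype_card, Nat.card_eq_fintype_card]
  linarith

theorem card_vertex_of_isTree [Fintype V] [Fintype G.edgeSet] (hG : G.IsTree) :
    Fintype.card (TFractalVertex G m) = (Fintype.card V - 1) * (m + 2) + 1 := by
  simp only [Fintype.card_sum, Fintype.card_prod, Fintype.card_fin,
    ← card_edgeSet_add_one_of_isTree hG, Nat.add_sub_cancel]
  ring

theorem isTree [Finite V] (hG : G.IsTree) : (tFractalGraph G m).IsTree := by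
  classical
  have := Fintype.ofFinite V
  rw [SimpleGraph.isTree_iff_connected_and_card, nat_card_edgeSet,
    Nat.card_eq_fintype_card (α := TFractalVertex G m), card_vertex_of_isTree m hG,
    Nat.card_eq_fintype_card, ← card_edgeSet_add_one_of_isTree hG, Nat.add_sub_cancel, mul_comm]
  exact ⟨connected m hG.connected, rfl⟩

end Order

section WienerIndex

variable {V : Type*} [Fintype V] {G : SimpleGraph V} [Fintype G.edgeSet] {m : ℕ}

theorem two_mul_sum_dist_mid [DecidableRel G.Adj] [DecidableEq V] (hG : G.IsTree)
    (v : TFractalVertex G m) :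
    2 * ∑ e, ((tFractalGraph G m).dist (.inr (.inl e)) v : ℝ) =
      ∑ x, (G.degree x : ℝ) * (tFractalGraph G m).dist (.inl x) v - 2 +
        ∑ x, if .inl x = v then 2 else 0 := by
  classical
  calc 2 * ∑ e, ((tFractalGraph G m).dist (.inr (.inl e)) v : ℝ)
      = ∑ x, ∑ u ∈ (tFractalGraph G m).neighborFinset (.inl x),
          ((tFractalGraph G m).dist u v : ℝ) := by
        simp only [sum_neighborFinset_old, sum_sum_edgeSet_mem, nsmul_eq_mul, Nat.cast_ofNat]
    _ = ∑ x, ((G.degree x : ℝ) * ((tFractalGraph G m).dist (.inl x) v + 1) - 2 +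
          if .inl x = v then 2 else 0) := by
        simp only [sum_neighborFinset_dist_of_isTree (isTree m hG), degree_old]
    _ = _ := by
        simp only [mul_add, mul_one, Finset.sum_add_distrib, Finset.sum_sub_distrib,
          sum_degree_of_isTree hG, Finset.sum_const, Finset.card_univ, nsmul_eq_mul]
        ring

omit [Fintype V] in
theorem mul_sum_dist_mid [Finite V] [DecidableEq V] (hG : G.IsTree) (v : TFractalVertex G m) :
    m * ∑ e, ((tFractalGraph G m).dist (.inr (.inl e)) v : ℝ) =
      ∑ p, ((tFractalGraph G m).dist (.inr (.inr p)) v : ℝ) - m * Fintype.card G.edgeSet +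
        ∑ p, if .inr (.inr p) = v then 2 else 0 := by
  classical
  have := Fintype.ofFinite V
  have hnbr (p : G.edgeSet × Fin m) :
      ((tFractalGraph G m).dist (.inr (.inl p.1)) v : ℝ) =
        (tFractalGraph G m).dist (.inr (.inr p)) v - 1 +
          if .inr (.inr p) = v then 2 else 0 := by
    rw [← sum_neighborFinset_leaf (fun u ↦ ((tFractalGraph G m).dist u v : ℝ)),
      sum_neighborFinset_dist_of_isTree (isTree m hG), degree_leaf]
    ring
  calc m * ∑ e, ((tFractalGraph G m).dist (.inr (.inl e)) v : ℝ)
      = ∑ p : G.edgeSet × Fin m, ((tFractalGraph G m).dist (.inr (.inl p.1)) v : ℝ) := by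
        simp [Fintype.sum_prod_type, Finset.mul_sum]
    _ = _ := by
        simp only [hnbr, Finset.sum_add_distrib, Finset.sum_sub_distrib, Finset.sum_const,
          Finset.card_univ, Fintype.card_prod, Fintype.card_fin, nsmul_eq_mul]
        push_cast
        ring

/-- The sum of the distances from a vertex of the T-fractal to the old vertices. -/
noncomputable def oldTransmission (v : TFractalVertex G m) : ℝ :=
  ∑ x : V, ((tFractalGraph G m).dist (.inl x) v : ℝ)

/-- The amount by which the transmission of a vertex of the T-fractal of a tree falls short of the
affine function of `oldTransmission` that gives the transmission of the old vertices. -/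
def transmissionDefect : TFractalVertex G m → ℝ
  | .inl _ => 0
  | .inr (.inl _) => m + 1
  | .inr (.inr _) => 2 * m + 4

-- `two_mul_sum_dist_mid` and `mul_sum_dist_mid` express the degree-weighted distance sum over the
-- old vertices and the distance sum over the leaves through the sum over the middle vertices; the
-- formula for the degree-weighted sum of all distances then determines the latter.
theorem transmission_add_transmissionDefect (hG : G.IsTree) (v : TFractalVertex G m) :
    transmission (tFractalGraph G m) v + transmissionDefect v =
      (m + 2) * oldTransmission v - (Fintype.card V - 1) := by
  classical
  have hT := isTree m hG
  have hE : (Fintype.card G.edgeSet : ℝ) + 1 = Fintype.card V := by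
    exact_mod_cast card_edgeSet_add_one_of_isTree hG
  have hold := two_mul_sum_dist_mid hG v
  have hleaf := mul_sum_dist_mid hG v
  have hcard : (Fintype.card (TFractalVertex G m) : ℝ) - 1 = (m + 2) * Fintype.card G.edgeSet := by
    rw [card_vertex_of_isTree m hG, ← card_edgeSet_add_one_of_isTree hG]
    push_cast
    ring
  have htotal : transmission (tFractalGraph G m) v =
      oldTransmission v + (∑ e, ((tFractalGraph G m).dist (.inr (.inl e)) v : ℝ) +
        ∑ p, ((tFractalGraph G m).dist (.inr (.inr p)) v : ℝ)) := by
    simp only [transmission, (tFractalGraph G m).dist_comm (u := v), Fintype.sum_sum_type,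
      oldTransmission]
  have hweighted := sum_degree_mul_dist_of_isTree hT v
  simp only [Fintype.sum_sum_type, degree_old, degree_mid, degree_leaf, ← Finset.mul_sum, hcard,
    htotal, Nat.cast_add, Nat.cast_ofNat, Nat.cast_one, one_mul] at hweighted
  rw [htotal]
  rcases v with y | e | p <;>
    simp only [transmissionDefect, Sum.inl.injEq, Sum.inr.injEq, reduceCtorEq, if_false,
      Finset.sum_ite_eq', Finset.mem_univ, if_true, Finset.sum_const_zero] at hold hleaf ⊢ <;>
    linear_combination ((m : ℝ) + 1) / 2 * (hweighted + hold - hleaf) - hleaf - hE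

omit [Fintype G.edgeSet] in
theorem oldTransmission_old (hG : G.Connected) (y : V) :
    oldTransmission (m := m) (.inl y : TFractalVertex G m) = 2 * transmission G y := by
  simp only [oldTransmission, transmission, dist_old_old hG, Nat.cast_mul, Nat.cast_ofNat,
    ← Finset.mul_sum, G.dist_comm (u := y)]

theorem sum_oldTransmission :
    ∑ v : TFractalVertex G m, oldTransmission v =
      ∑ y : V, transmission (tFractalGraph G m) (.inl y) := by
  simp only [oldTransmission, transmission]
  rw [Finset.sum_comm]

theorem sum_transmissionDefect :
    ∑ v : TFractalVertex G m, transmissionDefect v =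
      (2 * m ^ 2 + 5 * m + 1) * Fintype.card G.edgeSet := by
  simp only [Fintype.sum_sum_type, transmissionDefect, Finset.sum_const, Finset.card_univ,
    Fintype.card_prod, Fintype.card_fin, nsmul_eq_mul]
  push_cast
  ring

theorem wienerIndex_of_isTree (hG : G.IsTree) :
    wienerIndex (tFractalGraph G m) =
      2 * ((m : ℝ) + 2) ^ 2 * wienerIndex G - (m + 2) * (Fintype.card V : ℝ) ^ 2
        - (m - 1) * (m + 2) * Fintype.card V + (m ^ 2 + 2 * m) := by
  have hE : (Fintype.card G.edgeSet : ℝ) = Fintype.card V - 1 := by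
    rw [← card_edgeSet_add_one_of_isTree hG]
    push_cast
    ring
  have hcard : (Fintype.card (TFractalVertex G m) : ℝ) = (Fintype.card V - 1) * (m + 2) + 1 := by
    rw [card_vertex_of_isTree m hG, ← card_edgeSet_add_one_of_isTree hG]
    push_cast
    ring
  have hold (y : V) : transmission (tFractalGraph G m) (.inl y) =
      2 * (m + 2) * transmission G y - (Fintype.card V - 1) := by
    have h := transmission_add_transmissionDefect (m := m) hG (.inl y)
    rw [oldTransmission_old hG.connected, transmissionDefect] at h
    linarith
  have hsum := Finset.sum_congr rfl fun v (_ : v ∈ Finset.univ) ↦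
    transmission_add_transmissionDefect (m := m) hG v
  simp only [Finset.sum_add_distrib, Finset.sum_sub_distrib, ← Finset.mul_sum, sum_transmission,
    sum_oldTransmission, sum_transmissionDefect, hold, Finset.sum_const, Finset.card_univ,
    nsmul_eq_mul, hcard, hE] at hsum
  linear_combination hsum / 2

end WienerIndex

end tFractalGraph

theorem eq_pow_mul_add_sum_of_affine_recurrence {R : Type*} [CommSemiring R] {f : R} {u b : ℕ → R}
    (h : ∀ t, u (t + 1) = f * u t + b t) (t : ℕ) :
    u t = f ^ t * u 0 + ∑ i ∈ Finset.range t, f ^ i * b (t - 1 - i) := by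
  induction t with
  | zero => simp
  | succ t ih =>
    have hshift : ∀ i ∈ Finset.range t,
        f ^ (i + 1) * b (t + 1 - 1 - (i + 1)) = f * (f ^ i * b (t - 1 - i)) := fun i _ ↦ by
      rw [show t + 1 - 1 - (i + 1) = t - 1 - i by lia]
      ring
    rw [h, ih, Finset.sum_range_succ', Finset.sum_congr rfl hshift, ← Finset.mul_sum]
    simp only [pow_zero, one_mul, Nat.add_sub_cancel, Nat.sub_zero]
    ring

namespace generalizedTFractal

variable (m : ℕ) {T : FiniteGraph.{u}} (hT : T.graph.IsTree) (t : ℕ)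
include hT

theorem isTree : (generalizedTFractal m T t).graph.IsTree := by
  induction t with
  | zero => exact hT
  | succ t ih => exact tFractalGraph.isTree m ih

theorem order_eq : (generalizedTFractal m T t).order = (T.order - 1) * (m + 2) ^ t + 1 := by
  classical
  induction t with
  | zero =>
    have := hT.connected.nonempty
    have hpos : 0 < T.order := Fintype.card_pos
    simp only [generalizedTFractal, pow_zero]
    lia
  | succ t ih =>
    have hstep : (generalizedTFractal m T (t + 1)).order =
        ((generalizedTFractal m T t).order - 1) * (m + 2) + 1 :=
      tFractalGraph.card_vertex_of_isTree m (isTree m hT t)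
    rw [hstep, ih, Nat.add_sub_cancel, pow_succ, mul_assoc]

theorem wienerIndex_succ :
    wienerIndex (generalizedTFractal m T (t + 1)).graph =
      2 * ((m : ℝ) + 2) ^ 2 * wienerIndex (generalizedTFractal m T t).graph +
        (-(m + 2) * ((generalizedTFractal m T t).order : ℝ) ^ 2
          - (m - 1) * (m + 2) * (generalizedTFractal m T t).order + (m ^ 2 + 2 * m)) := by
  classical
  refine (tFractalGraph.wienerIndex_of_isTree (isTree m hT t)).trans ?_
  rw [FiniteGraph.order]
  ring

theorem wienerIndex_eq :
    wienerIndex (generalizedTFractal m T t).graph =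
      (2 * ((m : ℝ) + 2) ^ 2) ^ t * wienerIndex T.graph
        - (m + 2) * ∑ i ∈ Finset.range t, (2 * ((m : ℝ) + 2) ^ 2) ^ i *
            ((generalizedTFractal m T (t - 1 - i)).order : ℝ) ^ 2
        - (m - 1) * (m + 2) * ∑ i ∈ Finset.range t, (2 * ((m : ℝ) + 2) ^ 2) ^ i *
            ((generalizedTFractal m T (t - 1 - i)).order : ℝ)
        + (m ^ 2 + 2 * m) * ∑ i ∈ Finset.range t, (2 * ((m : ℝ) + 2) ^ 2) ^ i := by
  have hsolve := eq_pow_mul_add_sum_of_affine_recurrence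
    (u := fun t ↦ wienerIndex (generalizedTFractal m T t).graph) (wienerIndex_succ m hT) t
  rw [hsolve, generalizedTFractal]
  simp only [Finset.mul_sum, sub_eq_add_neg, ← Finset.sum_neg_distrib, add_assoc,
    ← Finset.sum_add_distrib]
  congr 1
  exact Finset.sum_congr rfl fun i _ ↦ by ring

end generalizedTFractal

theorem propositionI13 (m t : ℕ) (T : FiniteGraph.{u}) (hT : T.graph.IsTree) :
    ((generalizedTFractal m T t).order = (T.order - 1) * (m + 2) ^ t + 1) ∧
    (2 ≤ T.order →
      meanHittingTime (generalizedTFractal m T t).graph ≠ ⊤ ∧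
      (meanHittingTime (generalizedTFractal m T t).graph).toReal =
        (2 / ((generalizedTFractal m T t).order : ℝ)) *
          ((2 * ((m : ℝ) + 2) ^ 2) ^ t * wienerIndex T.graph
            - ((m : ℝ) + 2) * ∑ i ∈ Finset.range t, (2 * ((m : ℝ) + 2) ^ 2) ^ i *
                ((generalizedTFractal m T (t - 1 - i)).order : ℝ) ^ 2
            - (((m : ℝ) - 1) * ((m : ℝ) + 2)) *
                ∑ i ∈ Finset.range t, (2 * ((m : ℝ) + 2) ^ 2) ^ i *
                  ((generalizedTFractal m T (t - 1 - i)).order : ℝ)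
            + ((m : ℝ) ^ 2 + 2 * (m : ℝ)) *
                ∑ i ∈ Finset.range t, (2 * ((m : ℝ) + 2) ^ 2) ^ i)) := by
  have horder := generalizedTFractal.order_eq m hT t
  refine ⟨horder, fun hn ↦ ?_⟩
  have htwo : 2 ≤ (generalizedTFractal m T t).order := by
    have hpos : 0 < (T.order - 1) * (m + 2) ^ t := Nat.mul_pos (by lia) (by positivity)
    lia
  have hmean := meanHittingTime_of_isTree (generalizedTFractal.isTree m hT t) htwo
  rw [hmean, ← generalizedTFractal.wienerIndex_eq m hT t]
  have hW := wienerIndex_nonneg (generalizedTFractal m T t).graph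
  exact ⟨ENNReal.ofReal_ne_top, ENNReal.toReal_ofReal (by positivity)⟩
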